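/- **Theorem (shape parameters from lambda lengths).** Work in hyperbolic 3-space $\mathbb H^3$, with boundary at infinity $\mathbb C\cup\{\infty\}$ in the upper half-space model, and identify $\mathrm{Isom}^+\mathbb H^3\cong PSL(2,\mathbb C)$. Let $\Delta$ be a (nondegenerate) ideal tetrahedron with ideal vertices numbered $0,1,2,3$ so that the vertices $0,3,2$ appear in anticlockwise order as seen from vertex $1$ (equivalently, some orientation-preserving isometry takes the vertices $0,1,2,3$ to $0,\infty,z,1$ respectively, with $\operatorname{Im} z>0$). *Shape parameters.* For an edge $ij$ of $\Delta$, the shape parameter $z_{ij}$ is the unique complex number with $\operatorname{Im} z_{ij}>0$ for which some orientation-preserving isometry places the endpoints of the edge at $0$ and $\infty$ and the remaining two ideal vertices at $1$ and $z_{ij}$. *Spin-decorated horospheres.* A frame is a right-handed orthonormal frame $(f_1,f_2,f_3)$ at a point of $\mathbb H^3$; a spin frame is a point of the double cover $\mathrm{Spin}\cong SL(2,\mathbb C)$ of the frame bundle $\mathrm{Fr}\cong PSL(2,\mathbb C)$. On a horosphere $\mathcal h$ let $N^{out}$ and $N^{in}=-N^{out}$ be the unit normals pointing towards and away from its centre.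 A spin decoration on $\mathcal h$ is a pair $W=(W^{in},W^{out})$ of continuous lifts to $\mathrm{Spin}$ of the frame fields $(N^{in},\mathcal V,N^{in}\times\mathcal V)$ and $(N^{out},\mathcal V,N^{out}\times\mathcal V)$, for a unit tangent vector field $\mathcal V$ on $\mathcal h$ that is parallel (invariant under the parabolic isometries preserving $\mathcal h$), such that $W^{in}$ is obtained from $W^{out}$ by rotation of angle $\pi$ about $\mathcal V$. *Lambda lengths.* For spin-decorated horospheres $(\mathcal h_1,W_1),(\mathcal h_2,W_2)$ with distinct centres, let $\gamma$ be the geodesic oriented from the centre of $\mathcal h_1$ to that of $\mathcal h_2$ and $q_i=\gamma\cap\mathcal h_i$. Let $d=\rho+i\theta$ (well defined modulo $4\pi i$) be such that translation along $\gamma$ by signed distance $\rho$ followed by rotation about $\gamma$ by angle $\theta$ takes the spin frame $W_1^{in}(q_1)$ to the spin frame $W_2^{out}(q_2)$. The complex lambda length from $(\mathcal h_1,W_1)$ to $(\mathcal h_2,W_2)$ is $\exp(d/2)$; it is $0$ if the centres coincide. Choose any spin-decorated horosphere $(\mathcal h_i,W_i)$ centred at the ideal vertex $i$, for $i=0,1,2,3$,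 and let $\lambda_{ij}$ be the complex lambda length from $(\mathcal h_i,W_i)$ to $(\mathcal h_j,W_j)$. Then all six shape parameters exist, are unique, and are given by $$z_{01}=z_{23}=\frac{\lambda_{02}\lambda_{13}}{\lambda_{03}\lambda_{12}},\qquad z_{02}=z_{13}=-\frac{\lambda_{03}\lambda_{12}}{\lambda_{01}\lambda_{23}},\qquad z_{03}=z_{12}=\frac{\lambda_{01}\lambda_{23}}{\lambda_{02}\lambda_{13}}.$$ -/

import Mathlib

namespace SpinHorosphere

open Matrix

/-- The group of spin isometries of hyperbolic 3-space, the double (universal) cover of the group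
`PSL(2, ℂ)` of orientation-preserving isometries. -/
abbrev SL2 : Type := Matrix.SpecialLinearGroup (Fin 2) ℂ

/-! ### Minkowski space, the hyperboloid model and its boundary -/

/-- Minkowski space `ℝ^{1,3}`, with coordinates `(T, X, Y, Z)` numbered `0, 1, 2, 3`. -/
abbrev Mink : Type := Fin 4 → ℝ

/-- The Minkowski inner product `T T' - X X' - Y Y' - Z Z'`. -/
def mink (u v : Mink) : ℝ := u 0 * v 0 - u 1 * v 1 - u 2 * v 2 - u 3 * v 3

/-- The Hermitian matrix with Minkowski coordinates `(T, X, Y, Z)`. -/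
noncomputable def toHerm (v : Mink) : Matrix (Fin 2) (Fin 2) ℂ :=
  (1 / 2 : ℂ) • !![(v 0 : ℂ) + v 3, v 1 + v 2 * Complex.I; v 1 - v 2 * Complex.I, v 0 - v 3]

/-- The Minkowski coordinates of a Hermitian matrix. -/
def ofHerm (S : Matrix (Fin 2) (Fin 2) ℂ) : Mink :=
  ![(S 0 0 + S 1 1).re, 2 * (S 0 1).re, 2 * (S 0 1).im, (S 0 0 - S 1 1).re]

/-- The linear action of `SL(2, ℂ)` on Minkowski space, `S ↦ A S A*` on Hermitian matrices. -/
noncomputable def act (A : SL2) (v : Mink) : Mink :=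
  ofHerm ((A : Matrix (Fin 2) (Fin 2) ℂ) * toHerm v * (A : Matrix (Fin 2) (Fin 2) ℂ)ᴴ)

/-- The hyperboloid model of hyperbolic 3-space. -/
def hyperboloid : Set Mink := {x | mink x x = 1 ∧ 0 < x 0}

/-- The positive light cone `L⁺`. -/
def lightCone : Set Mink := {p | mink p p = 0 ∧ 0 < p 0}

/-- The horosphere cut out of the hyperboloid by the lightlike plane `⟨x, p⟩ = 1`, for `p ∈ L⁺`.
Every horosphere is of this form for exactly one `p ∈ L⁺`. -/
def horosphere (p : Mink) : Set Mink := {x | x ∈ hyperboloid ∧ mink x p = 1}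

open Classical in
/-- The point of `∂𝕌 = ℂ ∪ {∞}` (boundary at infinity of the upper half space model) represented
by the ray of the light cone through `p`: `(X + iY) / (T - Z)`, the stereographic projection of
`(X/T, Y/T, Z/T)`. -/
noncomputable def boundaryPoint (p : Mink) : OnePoint ℂ :=
  if p 0 = p 3 then OnePoint.infty
  else (((p 1 + p 2 * Complex.I) / (p 0 - p 3) : ℂ) : OnePoint ℂ)

/-- The point of the light cone with `T = 1` on the ray representing a point of `∂𝕌`; its
coordinates `(X, Y, Z)` are the corresponding point of the unit sphere, which is the boundary of
the ball models. -/
noncomputable def celestial : OnePoint ℂ → Mink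
  | none => ![1, 0, 0, 1]
  | some z => ![1, 2 * z.re / (1 + Complex.normSq z), 2 * z.im / (1 + Complex.normSq z),
      (Complex.normSq z - 1) / (1 + Complex.normSq z)]

/-- The action of orientation-preserving isometries on `∂𝕌 = ℂ ∪ {∞}` by Möbius
transformations. -/
noncomputable def moebius (A : SL2) (x : OnePoint ℂ) : OnePoint ℂ :=
  (A : Matrix.GeneralLinearGroup (Fin 2) ℂ) • x

/-- The geodesic in the hyperboloid whose endpoints at infinity are the rays through `p` and
`q`. -/
def geodesic (p q : Mink) : Set Mink := {x | x ∈ hyperboloid ∧ ∃ a b : ℝ, x = a • p + b • q}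

/-! ### Frames and spin frames -/

/-- A (right-handed orthonormal) frame `(e1, e2, e3)` at a point `pos` of the hyperboloid. Tangent
vectors at `x` are the vectors orthogonal to `x`, and the Riemannian metric is the restriction of
`-⟨·, ·⟩`. -/
@[ext] structure Frame where
  pos : Mink
  e1 : Mink
  e2 : Mink
  e3 : Mink
  pos_mem : pos ∈ hyperboloid
  tangent1 : mink pos e1 = 0
  tangent2 : mink pos e2 = 0
  tangent3 : mink pos e3 = 0
  unit1 : mink e1 e1 = -1
  unit2 : mink e2 e2 = -1
  unit3 : mink e3 e3 = -1
  orth12 : mink e1 e2 = 0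
  orth13 : mink e1 e3 = 0
  orth23 : mink e2 e3 = 0
  rightHanded : 0 < (Matrix.of ![pos, e1, e2, e3]).det

theorem det_parts (A : SL2) :
    ((A 0 0).re * (A 1 1).re - (A 0 0).im * (A 1 1).im
      - ((A 0 1).re * (A 1 0).re - (A 0 1).im * (A 1 0).im) = 1) ∧
    ((A 0 0).re * (A 1 1).im + (A 0 0).im * (A 1 1).re
      - ((A 0 1).re * (A 1 0).im + (A 0 1).im * (A 1 0).re) = 0) := by
  have hA := A.det_coe
  rw [Matrix.det_fin_two] at hA
  have h1 := congrArg Complex.re hA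
  have h2 := congrArg Complex.im hA
  simp only [Complex.sub_re, Complex.mul_re, Complex.one_re, Complex.sub_im, Complex.mul_im,
    Complex.one_im] at h1 h2
  exact ⟨h1, h2⟩

theorem mink_act (A : SL2) (u v : Mink) : mink (act A u) (act A v) = mink u v := by
  obtain ⟨h1, h2⟩ := det_parts A
  simp [act, ofHerm, toHerm, mink, Matrix.mul_apply, Fin.sum_univ_two]
  generalize (A 0 0).re = a at *
  generalize (A 0 0).im = a' at *
  generalize (A 0 1).re = b at *
  generalize (A 0 1).im = b' at *
  generalize (A 1 0).re = c at *
  generalize (A 1 0).im = c' at *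
  generalize (A 1 1).re = d at *
  generalize (A 1 1).im = d' at *
  linear_combination (u 0 * v 0 - u 1 * v 1 - u 2 * v 2 - u 3 * v 3) *
    ((a * d - a' * d' - (b * c - b' * c') + 1) * h1 + (a * d' + a' * d - (b * c' + b' * c)) * h2)

theorem act_zero_pos (A : SL2) : 0 < act A ![1, 0, 0, 0] 0 := by
  obtain ⟨h1, h2⟩ := det_parts A
  simp [act, ofHerm, toHerm, Matrix.mul_apply, Fin.sum_univ_two]
  generalize (A 0 0).re = a at *
  generalize (A 0 0).im = a' at *
  generalize (A 0 1).re = b at *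
  generalize (A 0 1).im = b' at *
  generalize (A 1 0).re = c at *
  generalize (A 1 0).im = c' at *
  generalize (A 1 1).re = d at *
  generalize (A 1 1).im = d' at *
  nlinarith [sq_nonneg (a - d), sq_nonneg (b + c), sq_nonneg (a' + d'),
    sq_nonneg (b' - c'), sq_nonneg a']

theorem det_act (A : SL2) :
    (Matrix.of ![act A ![1, 0, 0, 0], act A ![0, 0, 0, 1], act A ![0, 0, 1, 0],
      act A ![0, -1, 0, 0]]).det = 1 := by
  obtain ⟨h1, h2⟩ := det_parts A
  simp [act, ofHerm, toHerm, Matrix.mul_apply, Matrix.det_succ_row_zero, Fin.sum_univ_succ,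
    Fin.succAbove]
  generalize (A 0 0).re = a at *
  generalize (A 0 0).im = a' at *
  generalize (A 0 1).re = b at *
  generalize (A 0 1).im = b' at *
  generalize (A 1 0).re = c at *
  generalize (A 1 0).im = c' at *
  generalize (A 1 1).re = d at *
  generalize (A 1 1).im = d' at *
  trans ((a * d - a' * d' - (b * c - b' * c'))^2 + (a * d' + a' * d - (b * c' + b' * c))^2)^2
  · ring
  · rw [h1, h2]; norm_num

/-- A spin frame is a point of the double cover `Spin → Fr` of the frame bundle of hyperbolic
3-space. The frame bundle is `PSL(2, ℂ)`, acting simply transitively on frames, and its double and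
universal cover is realised by `SL(2, ℂ)` with the covering map `SpinFrame.frame`. -/
abbrev SpinFrame : Type := SL2

/-- The covering map `Spin → Fr`: the spin frame `A` lies over the image under the isometry `A` of
the base frame `(∂_Z, ∂_Y, -∂_X)` at `(1, 0, 0, 0)`, which is the frame `(e_z, e_y, -e_x)` at the
point `(0, 0, 1)` of the upper half space. -/
noncomputable def SpinFrame.frame (A : SpinFrame) : Frame where
  pos := act A ![1, 0, 0, 0]
  e1 := act A ![0, 0, 0, 1]
  e2 := act A ![0, 0, 1, 0]
  e3 := act A ![0, -1, 0, 0]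
  pos_mem := ⟨by rw [mink_act]; simp [mink], act_zero_pos A⟩
  tangent1 := by rw [mink_act]; simp [mink]
  tangent2 := by rw [mink_act]; simp [mink]
  tangent3 := by rw [mink_act]; simp [mink]
  unit1 := by rw [mink_act]; simp [mink]
  unit2 := by rw [mink_act]; simp [mink]
  unit3 := by rw [mink_act]; simp [mink]
  orth12 := by rw [mink_act]; simp [mink]
  orth13 := by rw [mink_act]; simp [mink]
  orth23 := by rw [mink_act]; simp [mink]
  rightHanded := by rw [det_act]; exact one_pos

/-- `G` is obtained from the frame `F` by the right-handed rotation of angle `θ` about `e1`. -/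
def Frame.IsRotation1 (θ : ℝ) (F G : Frame) : Prop :=
  G.pos = F.pos ∧ G.e1 = F.e1 ∧ G.e2 = Real.cos θ • F.e2 + Real.sin θ • F.e3 ∧
    G.e3 = Real.cos θ • F.e3 - Real.sin θ • F.e2

/-- `G` is obtained from the frame `F` by the right-handed rotation of angle `θ` about `e2`. -/
def Frame.IsRotation2 (θ : ℝ) (F G : Frame) : Prop :=
  G.pos = F.pos ∧ G.e2 = F.e2 ∧ G.e3 = Real.cos θ • F.e3 + Real.sin θ • F.e1 ∧
    G.e1 = Real.cos θ • F.e1 - Real.sin θ • F.e3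

/-- `G` is obtained from the frame `F` by (parallel) translation by the signed distance `ρ` along
the geodesic through `F.pos` oriented by `F.e1`. -/
def Frame.IsTranslation1 (ρ : ℝ) (F G : Frame) : Prop :=
  G.pos = Real.cosh ρ • F.pos + Real.sinh ρ • F.e1 ∧
    G.e1 = Real.sinh ρ • F.pos + Real.cosh ρ • F.e1 ∧ G.e2 = F.e2 ∧ G.e3 = F.e3

/-- Spin version of a one-parameter motion `R` of frames (with `R 0` the identity): the spin frame
`G` is the end point at parameter `a` of the continuous path of spin frames that starts at `F` and
lifts the path of frames given by moving the frame of `F` by `R s`. -/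
def SpinFrame.MovesTo (R : ℝ → Frame → Frame → Prop) (a : ℝ) (F G : SpinFrame) : Prop :=
  ∃ γ : ℝ → SpinFrame, Continuous γ ∧ γ 0 = F ∧ γ a = G ∧
    ∀ s, R s (SpinFrame.frame F) (SpinFrame.frame (γ s))

/-- `d = ρ + iθ` is a complex (translation) distance from the spin frame `F` to the spin frame `G`:
a translation of signed distance `ρ` along the oriented geodesic to which `F` is adapted, followed
by a rotation of angle `θ` about it, takes `F` to `G`. -/
def SpinFrame.IsComplexDistance (F G : SpinFrame) (d : ℂ) : Prop :=
  ∃ H : SpinFrame, SpinFrame.MovesTo Frame.IsTranslation1 d.re F H ∧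
    SpinFrame.MovesTo Frame.IsRotation1 d.im H G

/-! ### Spin-decorated horospheres and lambda lengths -/

/-- Parabolic elements of `SL(2, ℂ)`. -/
def IsParabolic (A : SL2) : Prop :=
  (A : Matrix (Fin 2) (Fin 2) ℂ).trace = 2 ∨ (A : Matrix (Fin 2) (Fin 2) ℂ).trace = -2

/-- `V` is a unit tangent vector field on the horosphere of `p` that is parallel, i.e. invariant
under the parabolic isometries preserving the horosphere. The tangent space of the horosphere at
`x` is `x^⊥ ∩ p^⊥`. -/
def IsUnitParallelField (p : Mink) (V : horosphere p → Mink) : Prop :=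
  (∀ x : horosphere p, mink (x : Mink) (V x) = 0 ∧ mink p (V x) = 0 ∧ mink (V x) (V x) = -1) ∧
  ∀ A : SL2, IsParabolic A → act A '' horosphere p = horosphere p →
    ∀ x y : horosphere p, (y : Mink) = act A x → V y = act A (V x)

/-- `W` is a continuous lift to spin frames of the outward frame field
`(N^out, V, N^out × V)` on the horosphere of `p`. The unit normal at `x` towards the centre is
`N^out = p - x`; the third vector is determined as frames are right-handed orthonormal. -/
def IsOutwardSpinLift (p : Mink) (V : horosphere p → Mink) (W : horosphere p → SpinFrame) : Prop :=
  Continuous W ∧ ∀ x, (SpinFrame.frame (W x)).pos = x ∧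
    (SpinFrame.frame (W x)).e1 = p - x ∧ (SpinFrame.frame (W x)).e2 = V x

/-- `W` is a continuous lift to spin frames of the inward frame field `(N^in, V, N^in × V)` on the
horosphere of `p`, where `N^in = x - p` is the unit normal at `x` away from the centre. -/
def IsInwardSpinLift (p : Mink) (V : horosphere p → Mink) (W : horosphere p → SpinFrame) : Prop :=
  Continuous W ∧ ∀ x, (SpinFrame.frame (W x)).pos = x ∧
    (SpinFrame.frame (W x)).e1 = x - p ∧ (SpinFrame.frame (W x)).e2 = V x

/-- A spin-decorated horosphere: a horosphere (given by its point of the light cone) with a pair of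
an inward and an outward spin decoration associated to each other, the inward one being obtained
from the outward one by rotation of angle `π` about the common parallel field `V`. -/
structure SpinDecoratedHorosphere where
  base : Mink
  base_mem : base ∈ lightCone
  inward : horosphere base → SpinFrame
  outward : horosphere base → SpinFrame
  exists_field : ∃ V : horosphere base → Mink, IsUnitParallelField base V ∧
    IsInwardSpinLift base V inward ∧ IsOutwardSpinLift base V outward
  associated : ∀ x, SpinFrame.MovesTo Frame.IsRotation2 Real.pi (outward x) (inward x)

/-- The centre of a spin-decorated horosphere, an ideal point in `∂𝕌 = ℂ ∪ {∞}`. -/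
noncomputable def SpinDecoratedHorosphere.centre (h : SpinDecoratedHorosphere) : OnePoint ℂ :=
  boundaryPoint h.base

/-- `d` is a complex distance from `h₁` to `h₂` (with distinct centres): the complex distance from
the inward spin frame of `h₁` at `q₁` to the outward spin frame of `h₂` at `q₂`, where `q₁`, `q₂`
are the intersection points of the two horospheres with the geodesic joining their centres. The
frame of `h₁` at `q₁` has first vector `N^in`, so it is adapted to this geodesic oriented from the
centre of `h₁` to the centre of `h₂`. -/
def IsComplexDistance (h₁ h₂ : SpinDecoratedHorosphere) (d : ℂ) : Prop :=
  ∃ (q₁ : horosphere h₁.base) (q₂ : horosphere h₂.base),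
    (q₁ : Mink) ∈ geodesic h₁.base h₂.base ∧ (q₂ : Mink) ∈ geodesic h₁.base h₂.base ∧
    SpinFrame.IsComplexDistance (h₁.inward q₁) (h₂.outward q₂) d

open Classical in
/-- The complex lambda length `λ = exp (d / 2)` from `h₁` to `h₂`, where `d` is the complex distance
from `h₁` to `h₂` (well defined modulo `4πi`); it is `0` if the centres coincide. -/
noncomputable def lambdaLength (h₁ h₂ : SpinDecoratedHorosphere) : ℂ :=
  if h₁.centre = h₂.centre then 0
  else Complex.exp (Classical.epsilon (IsComplexDistance h₁ h₂) / 2)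

/-! ### Ideal tetrahedra and shape parameters -/

/-- Four labelled ideal points are the vertices of a (nondegenerate) ideal tetrahedron, labelled
with the orientation for which the vertices `0, 3, 2` are in anticlockwise order as seen from the
vertex `1`. With `u i` the points of the unit sphere corresponding to the ideal points, the
determinant is `det (u 1 - u 0, u 2 - u 0, u 3 - u 0)`, six times the signed volume of the
tetrahedron with vertices `u i` (the ideal tetrahedron in the projective ball model). -/
def IsOrientedIdealTetrahedron (v : Fin 4 → OnePoint ℂ) : Prop :=
  (Matrix.of fun i => celestial (v i)).det < 0

/-- `z` is the shape parameter, along the edge joining the vertices `i` and `j`, of the ideal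
tetrahedron with ideal vertices `v`: an orientation-preserving isometry places the endpoints of the
edge at `0` and `∞`, and the two remaining ideal vertices at `1` and `z`, where `Im z > 0`. -/
def IsShapeParameter (v : Fin 4 → OnePoint ℂ) (i j : Fin 4) (z : ℂ) : Prop :=
  0 < z.im ∧ ∃ (A : SL2) (k l : Fin 4), ({i, j, k, l} : Finset (Fin 4)) = Finset.univ ∧
    ((moebius A (v i) = ((0 : ℂ) : OnePoint ℂ) ∧ moebius A (v j) = OnePoint.infty) ∨
      (moebius A (v i) = OnePoint.infty ∧ moebius A (v j) = ((0 : ℂ) : OnePoint ℂ))) ∧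
    moebius A (v k) = ((1 : ℂ) : OnePoint ℂ) ∧ moebius A (v l) = (z : OnePoint ℂ)

end SpinHorosphere

namespace SpinHorosphere

open Matrix Set

/-! A spin-decorated horosphere is encoded by a spinor κ ∈ ℂ². Motions relative to the moving frame
are right multiplications in `SL2`, and all outward spin frames of one decoration share their first
column κ, where κκ* is the light-cone vector of the horosphere (`IsOutwardSpinLift.column_eq`,
`SpinDecoratedHorosphere.exists_spinor`). Comparing columns in the equation that defines complex
distance gives λ = κ₀μ₁ − κ₁μ₀ (`lambdaLength_eq_bracket`), a form invariant under SL(2,ℂ).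

The ideal vertex is [κ₀ : κ₁], so a cross ratio of vertices is a ratio of products of brackets in
which the scale of each spinor cancels. A shape parameter is such a cross ratio, told apart from its
inverse by Im > 0 (`isShapeParameter_iff`).

It remains to fix signs. With Y = λ₀₂λ₁₃ and W = λ₀₃λ₁₂, the orientation determinant is a positive
multiple of −Im(Y W̄) (`det_spinorVec`), and the Plücker relation λ₀₁λ₂₃ = Y − W carries the
resulting sign to all three cross ratios (`im_cross_ratios`). -/

/-! ### The action of SL(2,ℂ) on Minkowski space -/

theorem ofHerm_toHerm (v : Mink) : ofHerm (toHerm v) = v := by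
  ext i
  fin_cases i <;> simp [ofHerm, toHerm] <;> ring

theorem toHerm_act (A : SL2) (v : Mink) :
    toHerm (act A v) = (A : Matrix (Fin 2) (Fin 2) ℂ) * toHerm v * (A : Matrix (Fin 2) (Fin 2) ℂ)ᴴ := by
  ext i j
  fin_cases i <;> fin_cases j <;> apply Complex.ext <;>
    simp [act, ofHerm, toHerm, Matrix.mul_apply, Fin.sum_univ_two] <;> ring

theorem act_mul (A B : SL2) (v : Mink) : act (A * B) v = act A (act B v) := by
  have h : ((A * B : SL2) : Matrix (Fin 2) (Fin 2) ℂ) = A * B := rfl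
  conv_rhs => rw [act, toHerm_act]
  rw [act, h, conjTranspose_mul]
  simp only [Matrix.mul_assoc]

theorem act_one (v : Mink) : act 1 v = v := by
  simp [act, ofHerm_toHerm]

theorem act_inv_act (A : SL2) (v : Mink) : act A⁻¹ (act A v) = v := by
  rw [← act_mul, inv_mul_cancel, act_one]

theorem act_act_inv (A : SL2) (v : Mink) : act A (act A⁻¹ v) = v := by
  rw [← act_mul, mul_inv_cancel, act_one]

theorem act_add (A : SL2) (u v : Mink) : act A (u + v) = act A u + act A v := by
  ext i
  fin_cases i <;> simp [act, ofHerm, toHerm, Matrix.mul_apply, Fin.sum_univ_two] <;> ring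

theorem act_smul (A : SL2) (r : ℝ) (v : Mink) : act A (r • v) = r • act A v := by
  ext i
  fin_cases i <;> simp [act, ofHerm, toHerm, Matrix.mul_apply, Fin.sum_univ_two] <;> ring

theorem act_sub (A : SL2) (u v : Mink) : act A (u - v) = act A u - act A v := by
  rw [eq_sub_iff_add_eq, ← act_add, sub_add_cancel]

theorem mink_comm (u v : Mink) : mink u v = mink v u := by
  simp only [mink]; ring

theorem mink_add_left (u v w : Mink) : mink (u + v) w = mink u w + mink v w := by
  simp only [mink, Pi.add_apply]; ring

theorem mink_add_right (u v w : Mink) : mink u (v + w) = mink u v + mink u w := by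
  simp only [mink, Pi.add_apply]; ring

theorem mink_smul_left (r : ℝ) (v w : Mink) : mink (r • v) w = r * mink v w := by
  simp only [mink, Pi.smul_apply, smul_eq_mul]; ring

theorem mink_smul_right (r : ℝ) (v w : Mink) : mink v (r • w) = r * mink v w := by
  simp only [mink, Pi.smul_apply, smul_eq_mul]; ring

/-- Reversed Cauchy–Schwarz: for spatial parts a, b one has (a·b)² < (1 + |a|²)(1 + |b|²) = (T T')².
-/
theorem mink_pos_of_mem_hyperboloid {u v : Mink} (hu : u ∈ hyperboloid) (hv : v ∈ hyperboloid) :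
    0 < mink u v := by
  obtain ⟨hu, hu0⟩ := hu
  obtain ⟨hv, hv0⟩ := hv
  simp only [mink] at *
  set s := u 1 * v 1 + u 2 * v 2 + u 3 * v 3
  have hs : s ^ 2 < (u 0 * v 0) ^ 2 := by
    have e : (u 0 * v 0) ^ 2 = (1 + (u 1 * u 1 + u 2 * u 2 + u 3 * u 3)) *
        (1 + (v 1 * v 1 + v 2 * v 2 + v 3 * v 3)) := by
      rw [mul_pow, show u 0 ^ 2 = 1 + (u 1 * u 1 + u 2 * u 2 + u 3 * u 3) by linarith,
        show v 0 ^ 2 = 1 + (v 1 * v 1 + v 2 * v 2 + v 3 * v 3) by linarith]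
    rw [e]
    simp only [s]
    nlinarith [sq_nonneg (u 1 * v 2 - u 2 * v 1), sq_nonneg (u 1 * v 3 - u 3 * v 1),
      sq_nonneg (u 2 * v 3 - u 3 * v 2), sq_nonneg (u 1), sq_nonneg (u 2), sq_nonneg (u 3),
      sq_nonneg (v 1), sq_nonneg (v 2), sq_nonneg (v 3)]
  have := abs_lt_of_sq_lt_sq hs (by positivity)
  have h2 := (abs_lt.mp this).2
  simp only [s] at h2
  linarith

theorem one_mem_hyperboloid : (![1, 0, 0, 0] : Mink) ∈ hyperboloid := by
  constructor <;> simp [mink]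

theorem act_mem_hyperboloid (A : SL2) {x : Mink} (hx : x ∈ hyperboloid) :
    act A x ∈ hyperboloid := by
  refine ⟨by rw [mink_act]; exact hx.1, ?_⟩
  -- The time coordinate is the product with the base point; moving `A` across makes it a product of
  -- two hyperboloid points.
  have h : act A x 0 = mink (act A x) ![1, 0, 0, 0] := by simp [mink]
  rw [h, ← act_act_inv A ![1, 0, 0, 0], mink_act]
  refine mink_pos_of_mem_hyperboloid hx ⟨?_, act_zero_pos _⟩
  rw [mink_act]; simp [mink]

theorem act_image_horosphere {A : SL2} {p : Mink} (hp : act A p = p) :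
    act A '' horosphere p = horosphere p := by
  have key : ∀ B : SL2, act B p = p → ∀ x ∈ horosphere p, act B x ∈ horosphere p := by
    intro B hB x hx
    refine ⟨act_mem_hyperboloid B hx.1, ?_⟩
    rw [← hB, mink_act]; exact hx.2
  ext y
  constructor
  · rintro ⟨x, hx, rfl⟩
    exact key A hp x hx
  · intro hy
    refine ⟨act A⁻¹ y, key A⁻¹ ?_ y hy, act_act_inv A y⟩
    conv_lhs => rw [← hp]
    exact act_inv_act A p

/-! ### Spinors and light-cone vectors -/

/-- The light-cone vector `κ κ*` of a spinor `κ`. -/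
noncomputable def spinorVec (κ : Fin 2 → ℂ) : Mink :=
  ![Complex.normSq (κ 0) + Complex.normSq (κ 1), 2 * (κ 0 * star (κ 1)).re,
    2 * (κ 0 * star (κ 1)).im, Complex.normSq (κ 0) - Complex.normSq (κ 1)]

theorem act_spinorVec (A : SL2) (κ : Fin 2 → ℂ) :
    act A (spinorVec κ) = spinorVec ((A : Matrix (Fin 2) (Fin 2) ℂ) *ᵥ κ) := by
  ext i
  fin_cases i <;>
    simp [act, ofHerm, toHerm, spinorVec, Matrix.mul_apply, Fin.sum_univ_two,
      Complex.normSq_apply] <;> ring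

/-- The symplectic form on spinors. -/
def bracket (κ μ : Fin 2 → ℂ) : ℂ := κ 0 * μ 1 - κ 1 * μ 0

/-- The Minkowski norm is 4 det on Hermitian matrices, and det(κκ* + μμ*) = |`bracket κ μ`|²;
polarise. -/
theorem mink_spinorVec (κ μ : Fin 2 → ℂ) :
    mink (spinorVec κ) (spinorVec μ) = 2 * Complex.normSq (bracket κ μ) := by
  simp [mink, spinorVec, bracket, Complex.normSq_apply]
  ring

theorem spinorVec_single : spinorVec ![1, 0] = ![1, 0, 0, 1] := by
  simp [spinorVec]

theorem act_north (A : SL2) : act A ![1, 0, 0, 1] = spinorVec ![A 0 0, A 1 0] := by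
  rw [← spinorVec_single, act_spinorVec]
  congr 1
  ext i; fin_cases i <;> simp

theorem act_south (A : SL2) : act A ![1, 0, 0, -1] = spinorVec ![A 0 1, A 1 1] := by
  have : (![1, 0, 0, -1] : Mink) = spinorVec ![0, 1] := by simp [spinorVec]
  rw [this, act_spinorVec]
  congr 1
  ext i; fin_cases i <;> simp

/-- Two nonzero spinors giving proportional light-cone vectors are proportional. -/
theorem bracket_eq_zero_of_spinorVec {κ μ : Fin 2 → ℂ} {r : ℝ}
    (h : spinorVec κ = r • spinorVec μ) : bracket κ μ = 0 := by
  have h1 := mink_spinorVec κ μ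
  rw [h, mink_smul_left, mink_spinorVec] at h1
  have h2 : bracket μ μ = 0 := by simp only [bracket]; ring
  rw [h2] at h1
  simpa using h1.symm

theorem spinorVec_eq_north {κ : Fin 2 → ℂ} (h : spinorVec κ = ![1, 0, 0, 1]) :
    κ 1 = 0 ∧ Complex.normSq (κ 0) = 1 := by
  have h0 := congrFun h 0
  have h3 := congrFun h 3
  simp [spinorVec] at h0 h3
  have h1 : Complex.normSq (κ 1) = 0 := by linarith
  exact ⟨Complex.normSq_eq_zero.mp h1, by linarith⟩

theorem det_eq (A : SL2) : A 0 0 * A 1 1 - A 0 1 * A 1 0 = 1 := by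
  have := A.det_coe
  rwa [Matrix.det_fin_two] at this

theorem ext_SL2 {A B : SL2} (h00 : A 0 0 = B 0 0) (h01 : A 0 1 = B 0 1) (h10 : A 1 0 = B 1 0)
    (h11 : A 1 1 = B 1 1) : A = B := by
  ext i j
  fin_cases i <;> fin_cases j <;> assumption

/-- An upper triangular element with unitary diagonal that fixes `∂_Y` has diagonal entries
`±1`. -/
theorem sq_eq_one_of_act_fix {u t s : ℂ} (hus : u * s = 1) {C : SL2} (h00 : C 0 0 = u)
    (h01 : C 0 1 = t) (h10 : C 1 0 = 0) (h11 : C 1 1 = s) (hu : Complex.normSq u = 1)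
    (hY : act C ![0, 0, 1, 0] = ![0, 0, 1, 0]) : u ^ 2 = 1 := by
  -- The off-diagonal entry of C S C*, for S the matrix of ∂_Y, is i·u·s̄/2, independent of `t`. As
  -- s = ū, it is i·u²/2, to be compared with i/2.
  have h1 := congrFun hY 1
  have h2 := congrFun hY 2
  simp [act, ofHerm, toHerm, Matrix.mul_apply, Fin.sum_univ_two, h00, h01, h10, h11] at h1 h2
  have hs : s = (starRingEnd ℂ) u := by
    have h := Complex.mul_conj u
    rw [hu] at h
    have hu0 : u ≠ 0 := left_ne_zero_of_mul_eq_one hus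
    apply mul_left_cancel₀ hu0
    rw [hus, h]; simp
  subst hs
  rw [Complex.normSq_apply] at hu
  apply Complex.ext
  · simp [pow_two] at h1 h2 ⊢
    nlinarith
  · simp [pow_two] at h1 h2 ⊢
    nlinarith

theorem mul_entry (A B : SL2) (i j : Fin 2) :
    (A * B : SL2) i j = A i 0 * B 0 j + A i 1 * B 1 j := by
  rw [show ((A * B : SL2) : Matrix (Fin 2) (Fin 2) ℂ) = A * B from rfl, Matrix.mul_apply,
    Fin.sum_univ_two]

theorem continuous_SL2 {X : Type*} [TopologicalSpace X] {f : X → SL2}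
    (h : ∀ i j, Continuous fun x => f x i j) : Continuous f :=
  Continuous.subtype_mk (f := fun x => (f x : Matrix (Fin 2) (Fin 2) ℂ)) (continuous_matrix h) _

theorem continuous_entry {X : Type*} [TopologicalSpace X] {f : X → SL2} (h : Continuous f)
    (i j : Fin 2) : Continuous fun x => f x i j :=
  (continuous_subtype_val.comp h).matrix_elem i j

/-! ### Lifting motions of frames to spin frames -/

/-- Spin frames over the same frame differ by the deck transformation. -/
theorem SpinFrame.eq_or_eq_neg_of_frame_eq {A B : SpinFrame}
    (h : SpinFrame.frame A = SpinFrame.frame B) : A = B ∨ A = -B := by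
  have h0 : act (B⁻¹ * A) ![1, 0, 0, 0] = ![1, 0, 0, 0] := by
    rw [act_mul, show act A _ = act B _ from congrArg Frame.pos h, act_inv_act]
  have h1 : act (B⁻¹ * A) ![0, 0, 0, 1] = ![0, 0, 0, 1] := by
    rw [act_mul, show act A _ = act B _ from congrArg Frame.e1 h, act_inv_act]
  have h2 : act (B⁻¹ * A) ![0, 0, 1, 0] = ![0, 0, 1, 0] := by
    rw [act_mul, show act A _ = act B _ from congrArg Frame.e2 h, act_inv_act]
  obtain ⟨C, hC⟩ : ∃ C : SL2, C = B⁻¹ * A := ⟨_, rfl⟩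
  rw [← hC] at h0 h1 h2
  have hA : A = B * C := by rw [hC]; group
  -- Fixing the two null vectors pos ± e1 makes `C` diagonal; fixing ∂_Y then leaves only ±1.
  have hn : act C ![1, 0, 0, 1] = ![1, 0, 0, 1] := by
    rw [show (![1, 0, 0, 1] : Mink) = ![1, 0, 0, 0] + ![0, 0, 0, 1] by simp, act_add, h0, h1]
  have hs : act C ![1, 0, 0, -1] = ![1, 0, 0, -1] := by
    rw [show (![1, 0, 0, -1] : Mink) = ![1, 0, 0, 0] - ![0, 0, 0, 1] by simp, act_sub, h0, h1]
  have hn' := spinorVec_eq_north ((act_north C).symm.trans hn)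
  simp only [cons_val_zero, cons_val_one] at hn'
  have h01 : C 0 1 = 0 := by
    rw [act_south] at hs
    have e0 := congrFun hs 0
    have e3 := congrFun hs 3
    simp [spinorVec] at e0 e3
    exact Complex.normSq_eq_zero.mp (by linarith)
  have hd := det_eq C
  rw [h01, zero_mul, sub_zero] at hd
  have hu := sq_eq_one_of_act_fix hd rfl h01 hn'.1 rfl hn'.2 h2
  have h11 : C 1 1 = C 0 0 := by
    have h00 : C 0 0 ≠ 0 := left_ne_zero_of_mul_eq_one hd
    apply mul_left_cancel₀ h00
    rw [hd, ← pow_two, hu]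
  rcases (sq_eq_sq_iff_eq_or_eq_neg (b := (1 : ℂ))).mp (by rw [hu, one_pow]) with h' | h'
  · left
    rw [hA, show C = 1 from ext_SL2 (by simp [h']) (by simp [h01]) (by simp [hn'.1])
      (by simp [h11, h']), mul_one]
  · right
    rw [hA, show C = -1 from ext_SL2 (by simp [h']) (by simp [h01]) (by simp [hn'.1])
      (by simp [h11, h']), mul_neg, mul_one]

/-- The quotient δ⁻¹γ is continuous with values ±1 on the connected line, so its corner entry keeps
its initial value 1. -/
theorem SpinFrame.eq_of_continuous_lift {γ δ : ℝ → SpinFrame} (hγ : Continuous γ)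
    (hδ : Continuous δ) (h0 : γ 0 = δ 0)
    (h : ∀ s, SpinFrame.frame (γ s) = SpinFrame.frame (δ s)) (s : ℝ) : γ s = δ s := by
  have hc : ∀ s, (δ s)⁻¹ * γ s = 1 ∨ (δ s)⁻¹ * γ s = -1 := by
    intro s
    rcases SpinFrame.eq_or_eq_neg_of_frame_eq (h s) with e | e
    · left; rw [e, inv_mul_cancel]
    · right; rw [e, mul_neg, inv_mul_cancel]
  have hcont : Continuous fun s => ((δ s)⁻¹ * γ s : SL2) 0 0 :=
    continuous_entry (hδ.inv.mul hγ) 0 0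
  have key := isPreconnected_univ.eq_of_sq_eq (f := fun s => ((δ s)⁻¹ * γ s : SL2) 0 0)
    (g := fun _ => (1 : ℂ)) hcont.continuousOn continuousOn_const
    (fun s _ => by rcases hc s with e | e <;> simp only [Pi.pow_apply, e] <;> simp) (fun _ => one_ne_zero)
    (mem_univ (0 : ℝ)) (by simp [h0]) (mem_univ s)
  rcases hc s with e | e
  · exact (inv_mul_eq_one.mp e).symm
  · simp only [e] at key
    norm_num at key

/-- The path s ↦ F · D s is one lift of the motion. Since `R` determines the moved frame (`hR`),
uniqueness of lifts makes it the only one. -/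
theorem SpinFrame.movesTo_iff {R : ℝ → Frame → Frame → Prop} {D : ℝ → SL2} (hD : Continuous D)
    (hD0 : D 0 = 1) (hR : ∀ s F G G', R s F G → R s F G' → G = G')
    (hRD : ∀ s (F : SpinFrame), R s (SpinFrame.frame F) (SpinFrame.frame (F * D s : SL2)))
    (a : ℝ) (F G : SpinFrame) : SpinFrame.MovesTo R a F G ↔ G = F * D a := by
  have hc : Continuous fun s => F * D s := continuous_const.mul hD
  constructor
  · rintro ⟨γ, hγ, h0, rfl, h⟩
    exact SpinFrame.eq_of_continuous_lift hγ hc (by simp [h0, hD0])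
      (fun s => hR s _ _ _ (h s) (hRD s F)) a
  · rintro rfl
    exact ⟨fun s => F * D s, hc, by simp [hD0], rfl, fun s => hRD s F⟩

/-! ### Translations and rotations as one-parameter subgroups -/

/-- The diagonal matrix `diag(exp w, exp (-w))`. -/
noncomputable def expDiag (w : ℂ) : SL2 :=
  ⟨!![Complex.exp w, 0; 0, Complex.exp (-w)], by simp [Matrix.det_fin_two, ← Complex.exp_add]⟩

/-- The real rotation matrix of angle `φ`. -/
noncomputable def rot (φ : ℝ) : SL2 :=
  ⟨!![(Real.cos φ : ℂ), -(Real.sin φ : ℂ); (Real.sin φ : ℂ), (Real.cos φ : ℂ)], by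
    simp only [Matrix.det_fin_two, of_apply, cons_val', cons_val_zero, cons_val_one,
      empty_val', cons_val_fin_one]
    have := Real.cos_sq_add_sin_sq φ
    norm_cast
    linarith⟩

@[simp] theorem expDiag_apply (w : ℂ) (i j : Fin 2) :
    expDiag w i j = (!![Complex.exp w, 0; 0, Complex.exp (-w)] : Matrix _ _ ℂ) i j := rfl

@[simp] theorem rot_apply (φ : ℝ) (i j : Fin 2) : rot φ i j =
    (!![(Real.cos φ : ℂ), -(Real.sin φ : ℂ); (Real.sin φ : ℂ), (Real.cos φ : ℂ)] :
      Matrix _ _ ℂ) i j := rfl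

theorem expDiag_zero : expDiag 0 = 1 := by
  apply ext_SL2 <;> simp

theorem expDiag_add (w w' : ℂ) : expDiag (w + w') = expDiag w * expDiag w' := by
  apply ext_SL2 <;> rw [mul_entry] <;> simp [← Complex.exp_add, add_comm]

theorem rot_zero : rot 0 = 1 := by
  apply ext_SL2 <;> simp

theorem continuous_expDiag : Continuous expDiag := by
  apply continuous_SL2
  intro i j
  fin_cases i <;> fin_cases j <;> simp <;> fun_prop

theorem continuous_rot : Continuous rot := by
  apply continuous_SL2
  intro i j
  fin_cases i <;> fin_cases j <;> simp <;> fun_prop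

/-- Translation by 2 Re w along the Z-axis and rotation by 2 Im w about it. The doubling is the
source of the halves in exp(d/2). -/
theorem act_expDiag (w : ℂ) (v : Mink) :
    act (expDiag w) v =
      ![Real.cosh (2 * w.re) * v 0 + Real.sinh (2 * w.re) * v 3,
        Real.cos (2 * w.im) * v 1 - Real.sin (2 * w.im) * v 2,
        Real.sin (2 * w.im) * v 1 + Real.cos (2 * w.im) * v 2,
        Real.sinh (2 * w.re) * v 0 + Real.cosh (2 * w.re) * v 3] := by
  have h1 : Real.exp (2 * w.re) = Real.exp w.re * Real.exp w.re := by
    rw [two_mul, Real.exp_add]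
  have h2 : Real.exp (-(2 * w.re)) = Real.exp (-w.re) * Real.exp (-w.re) := by
    rw [two_mul, neg_add, Real.exp_add]
  have h3 : Real.exp w.re * Real.exp (-w.re) = 1 := by rw [← Real.exp_add]; simp
  have h4 := Real.cos_sq_add_sin_sq w.im
  ext i
  fin_cases i <;>
    simp [act, ofHerm, toHerm, Matrix.mul_apply, Fin.sum_univ_two, Complex.exp_re, Complex.exp_im,
      Real.cosh_eq, Real.sinh_eq, h1, h2, Real.cos_two_mul', Real.sin_two_mul] <;>
    generalize Real.exp w.re = x at * <;> generalize Real.exp (-w.re) = y at * <;>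
    generalize Real.cos w.im = c at * <;> generalize Real.sin w.im = s at *
  · linear_combination (1 / 2) * (x * x * (v 0 + v 3) + y * y * (v 0 - v 3)) * h4
  · linear_combination (v 1 * (c ^ 2 - s ^ 2) - v 2 * (2 * s * c)) * h3
  · linear_combination (v 2 * (c ^ 2 - s ^ 2) + v 1 * (2 * s * c)) * h3
  · linear_combination (1 / 2) * (x * x * (v 0 + v 3) - y * y * (v 0 - v 3)) * h4

theorem act_rot (φ : ℝ) (v : Mink) :
    act (rot φ) v =
      ![v 0, Real.cos (2 * φ) * v 1 + Real.sin (2 * φ) * v 3, v 2,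
        Real.cos (2 * φ) * v 3 - Real.sin (2 * φ) * v 1] := by
  have h4 := Real.cos_sq_add_sin_sq φ
  ext i
  fin_cases i <;>
    simp [act, ofHerm, toHerm, Matrix.mul_apply, Fin.sum_univ_two,
      Real.cos_two_mul', Real.sin_two_mul, -Complex.ofReal_cos, -Complex.ofReal_sin] <;>
    generalize Real.cos φ = c at * <;> generalize Real.sin φ = s at *
  · linear_combination v 0 * h4
  · ring
  · linear_combination v 2 * h4
  · ring

theorem SpinFrame.movesTo_translation (ρ : ℝ) (F G : SpinFrame) :
    SpinFrame.MovesTo Frame.IsTranslation1 ρ F G ↔ G = F * expDiag (ρ / 2) := by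
  refine SpinFrame.movesTo_iff (D := fun s : ℝ => expDiag (s / 2))
    (continuous_expDiag.comp (by fun_prop)) (by simp [expDiag_zero]) ?_ ?_ ρ F G
  · rintro s F G G' ⟨a, b, c, d⟩ ⟨a', b', c', d'⟩
    exact Frame.ext (a.trans a'.symm) (b.trans b'.symm) (c.trans c'.symm) (d.trans d'.symm)
  · intro s F
    refine ⟨?_, ?_, ?_, ?_⟩ <;>
      simp only [SpinFrame.frame, act_mul, ← act_smul, ← act_add] <;>
      congr 1 <;> rw [act_expDiag] <;> ext i <;> fin_cases i <;> simp [mul_div_cancel₀]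

theorem SpinFrame.movesTo_rotation1 (θ : ℝ) (F G : SpinFrame) :
    SpinFrame.MovesTo Frame.IsRotation1 θ F G ↔ G = F * expDiag (θ * Complex.I / 2) := by
  refine SpinFrame.movesTo_iff (D := fun s : ℝ => expDiag (s * Complex.I / 2))
    (continuous_expDiag.comp (by fun_prop)) (by simp [expDiag_zero]) ?_ ?_ θ F G
  · rintro s F G G' ⟨a, b, c, d⟩ ⟨a', b', c', d'⟩
    exact Frame.ext (a.trans a'.symm) (b.trans b'.symm) (c.trans c'.symm) (d.trans d'.symm)
  · intro s F
    refine ⟨?_, ?_, ?_, ?_⟩ <;>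
      simp only [SpinFrame.frame, act_mul, ← act_smul, ← act_add, ← act_sub] <;>
      congr 1 <;> rw [act_expDiag] <;> ext i <;> fin_cases i <;> simp [mul_div_cancel₀]

theorem SpinFrame.movesTo_rotation2 (θ : ℝ) (F G : SpinFrame) :
    SpinFrame.MovesTo Frame.IsRotation2 θ F G ↔ G = F * rot (θ / 2) := by
  refine SpinFrame.movesTo_iff (D := fun s : ℝ => rot (s / 2))
    (continuous_rot.comp (by fun_prop)) (by simp [rot_zero]) ?_ ?_ θ F G
  · rintro s F G G' ⟨a, b, c, d⟩ ⟨a', b', c', d'⟩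
    exact Frame.ext (a.trans a'.symm) (d.trans d'.symm) (b.trans b'.symm) (c.trans c'.symm)
  · intro s F
    refine ⟨?_, ?_, ?_, ?_⟩ <;>
      simp only [SpinFrame.frame, act_mul, ← act_smul, ← act_add, ← act_sub] <;>
      congr 1 <;> rw [act_rot] <;> ext i <;> fin_cases i <;> simp [mul_div_cancel₀]

/-- Translation and rotation both become diagonal matrices, whose exponents add. In this form the
ambiguity of `d` is visibly 4πi. -/
theorem SpinFrame.isComplexDistance_iff (F G : SpinFrame) (d : ℂ) :
    SpinFrame.IsComplexDistance F G d ↔ G = F * expDiag (d / 2) := by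
  simp only [SpinFrame.IsComplexDistance, SpinFrame.movesTo_translation,
    SpinFrame.movesTo_rotation1, exists_eq_left]
  rw [mul_assoc, ← expDiag_add, ← add_div, Complex.re_add_im]

/-! ### From spin decorations to spinors -/

/-- The upper unipotent matrix with off-diagonal entry `t`. -/
def unip (t : ℂ) : SL2 := ⟨!![1, t; 0, 1], by simp [Matrix.det_fin_two]⟩

@[simp] theorem unip_apply (t : ℂ) (i j : Fin 2) :
    unip t i j = (!![1, t; 0, 1] : Matrix _ _ ℂ) i j := rfl

theorem continuous_unip : Continuous unip := by
  apply continuous_SL2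
  intro i j
  fin_cases i <;> fin_cases j <;> simp <;> fun_prop

theorem act_unip_north (t : ℂ) : act (unip t) ![1, 0, 0, 1] = ![1, 0, 0, 1] := by
  rw [act_north]; simp [spinorVec]

/-- For an outward spin frame `A`, these conjugates fix the light-cone vector of the horosphere, so
the invariance of parallel fields applies to them. -/
theorem isParabolic_conj_unip (A : SL2) (t : ℂ) : IsParabolic (A * unip t * A⁻¹) := by
  left
  rw [show ((A * unip t * A⁻¹ : SL2) : Matrix (Fin 2) (Fin 2) ℂ) =
    A * unip t * (A⁻¹ : SL2) from rfl, Matrix.trace_mul_cycle,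
    show ((A⁻¹ : SL2) : Matrix (Fin 2) (Fin 2) ℂ) * A = 1 from
      congrArg Subtype.val (inv_mul_cancel A), Matrix.one_mul, Matrix.trace_fin_two]
  simp
  norm_num

theorem continuous_act_left (v : Mink) : Continuous fun A : SL2 => act A v := by
  have h : ∀ i j, Continuous fun A : SL2 => A i j := continuous_entry continuous_id
  unfold act ofHerm
  apply continuous_pi
  intro i
  fin_cases i <;> simp [Matrix.mul_apply, Fin.sum_univ_two] <;> fun_prop

theorem act_base_mem_horosphere (A : SL2) :
    act A ![1, 0, 0, 0] ∈ horosphere (act A ![1, 0, 0, 1]) :=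
  ⟨act_mem_hyperboloid A one_mem_hyperboloid, by rw [mink_act]; simp [mink]⟩

theorem base_add_e1 (A : SL2) : (SpinFrame.frame A).pos + (SpinFrame.frame A).e1 =
    act A ![1, 0, 0, 1] := by
  simp [SpinFrame.frame, ← act_add]

theorem base_sub_e1 (A : SL2) : (SpinFrame.frame A).pos - (SpinFrame.frame A).e1 =
    act A ![1, 0, 0, -1] := by
  simp [SpinFrame.frame, ← act_sub]

theorem IsOutwardSpinLift.act_north {p : Mink} {V : horosphere p → Mink}
    {W : horosphere p → SpinFrame} (hW : IsOutwardSpinLift p V W) (x : horosphere p) :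
    act (W x) ![1, 0, 0, 1] = p := by
  obtain ⟨h1, h2, -⟩ := hW.2 x
  rw [← base_add_e1, h1, h2, add_sub_cancel]

/-- Outward spin frames of a parallel field differ by a parabolic isometry, up to sign. -/
theorem IsOutwardSpinLift.transition {p : Mink} {V : horosphere p → Mink}
    {W : horosphere p → SpinFrame} (hV : IsUnitParallelField p V)
    (hW : IsOutwardSpinLift p V W) (x y : horosphere p) :
    ((W x)⁻¹ * W y : SL2) 1 0 = 0 ∧ (((W x)⁻¹ * W y : SL2) 0 0) ^ 2 = 1 := by
  obtain ⟨C, hC⟩ : ∃ C : SL2, C = (W x)⁻¹ * W y := ⟨_, rfl⟩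
  have hy : W y = W x * C := by rw [hC]; group
  rw [← hC]
  have hn : act C ![1, 0, 0, 1] = ![1, 0, 0, 1] := by
    rw [hC, act_mul, hW.act_north y]
    conv_lhs => rw [← hW.act_north x]
    exact act_inv_act _ _
  obtain ⟨h10, h00⟩ := spinorVec_eq_north ((SpinHorosphere.act_north C).symm.trans hn)
  simp only [cons_val_zero, cons_val_one] at h10 h00
  refine ⟨h10, ?_⟩
  have hd := det_eq C
  rw [h10, mul_zero, sub_zero] at hd
  -- Split the upper triangular `C` as unipotent times diagonal. The unipotent entry is C₀₁/C₁₁,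
  -- which equals C₀₁C₀₀ because det C = 1.
  obtain ⟨D, hD⟩ : ∃ D : SL2, D = (unip (C 0 1 * C 0 0))⁻¹ * C := ⟨_, rfl⟩
  have hCD : C = unip (C 0 1 * C 0 0) * D := by rw [hD]; group
  have e : ∀ i j, C i j = unip (C 0 1 * C 0 0) i 0 * D 0 j + unip (C 0 1 * C 0 0) i 1 * D 1 j := by
    intro i j
    conv_lhs => rw [hCD]
    exact mul_entry _ _ i j
  have e10 := e 1 0
  have e11 := e 1 1
  have e00 := e 0 0
  have e01 := e 0 1
  simp [h10] at e10 e11 e00 e01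
  rw [← e10, mul_zero, add_zero] at e00
  rw [← e11] at e01
  have d01 : D 0 1 = 0 := by linear_combination (-1 : ℂ) * e01 - C 0 1 * hd
  refine sq_eq_one_of_act_fix hd e00.symm d01 e10.symm e11.symm h00 ?_
  -- `P` is a parabolic preserving the horosphere and takes `x` to `y`, since `D` fixes the base
  -- point. Invariance of `V` under `P`, after cancelling `W x * N`, says that `D` fixes ∂_Y.
  set N := unip (C 0 1 * C 0 0)
  set P := W x * N * (W x)⁻¹
  have hP : act P p = p := by
    conv_lhs => rw [← hW.act_north x]
    rw [← act_mul, inv_mul_cancel_right, act_mul, act_unip_north, hW.act_north x]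
  have hD1 : act D ![1, 0, 0, 0] = ![1, 0, 0, 0] := by
    ext i
    have h2 : Complex.normSq (C 1 1) = 1 := by
      have := congrArg Complex.normSq hd
      rw [map_mul, h00] at this
      simpa using this
    rw [Complex.normSq_apply] at h00 h2
    fin_cases i <;>
      simp [act, ofHerm, toHerm, Matrix.mul_apply, Fin.sum_univ_two, ← e00, d01, ← e10, ← e11] <;>
      linarith
  have hpos : (y : Mink) = act P x := by
    rw [← (hW.2 y).1, ← (hW.2 x).1]
    simp only [SpinFrame.frame]
    rw [← act_mul, inv_mul_cancel_right, hy, hCD, ← mul_assoc, act_mul (W x * N), hD1]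
  have hVy := hV.2 P (isParabolic_conj_unip _ _) (act_image_horosphere hP) x y hpos
  rw [← (hW.2 y).2.2, ← (hW.2 x).2.2] at hVy
  simp only [SpinFrame.frame] at hVy
  rw [← act_mul, inv_mul_cancel_right, hy, hCD, ← mul_assoc, act_mul (W x * N)] at hVy
  have := congrArg (act (W x * N)⁻¹) hVy
  rwa [act_inv_act, act_inv_act] at this

/-- The first columns of the outward spin frames of a parallel field agree. -/
theorem IsOutwardSpinLift.column_eq {p : Mink} {V : horosphere p → Mink}
    {W : horosphere p → SpinFrame} (hV : IsUnitParallelField p V)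
    (hW : IsOutwardSpinLift p V W) (x y : horosphere p) (i : Fin 2) : W y i 0 = W x i 0 := by
  have hmem : ∀ t : ℂ, act (W x * unip t) ![1, 0, 0, 0] ∈ horosphere p := by
    intro t
    have h := act_base_mem_horosphere (W x * unip t)
    rwa [act_mul _ _ ![1, 0, 0, 1], act_unip_north, hW.act_north x] at h
  -- A continuous parametrisation of the horosphere by ℂ. Connectedness of ℂ then removes the sign
  -- ambiguity left by `transition`.
  let ψ : ℂ → horosphere p := fun t => ⟨act (W x * unip t) ![1, 0, 0, 0], hmem t⟩
  have hψ : Continuous ψ := by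
    apply Continuous.subtype_mk
    exact (continuous_act_left _).comp (continuous_const.mul continuous_unip)
  have hx : ψ 0 = x := by
    apply Subtype.ext
    have h1 : unip 0 = 1 := by apply ext_SL2 <;> simp
    simp only [ψ, h1, mul_one]
    exact (hW.2 x).1
  have hcont : Continuous fun t => ((W x)⁻¹ * W (ψ t) : SL2) 0 0 :=
    continuous_entry (continuous_const.mul (hW.1.comp hψ)) 0 0
  have key := isPreconnected_univ.eq_of_sq_eq (f := fun t => ((W x)⁻¹ * W (ψ t) : SL2) 0 0)
    (g := fun _ => (1 : ℂ)) hcont.continuousOn continuousOn_const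
    (fun t _ => by
      simp only [Pi.pow_apply, one_pow]
      exact (hW.transition hV x (ψ t)).2) (fun _ => one_ne_zero)
    (mem_univ (0 : ℂ)) (by simp only [hx, inv_mul_cancel]; simp)
  obtain ⟨h10, h00⟩ := hW.transition hV x y
  obtain ⟨C, hC⟩ : ∃ C : SL2, C = (W x)⁻¹ * W y := ⟨_, rfl⟩
  have hy : W y = W x * C := by rw [hC]; group
  rw [← hC] at h10 h00
  have hd := det_eq C
  rw [h10, mul_zero, sub_zero] at hd
  -- `C` is ± a unipotent, and the sign does not affect the action on Minkowski space; so every `y`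
  -- lies in the image of ψ.
  have hyψ : ψ (C 0 1 * C 0 0) = y := by
    apply Subtype.ext
    simp only [ψ]
    rw [← (hW.2 y).1]
    simp only [SpinFrame.frame]
    rw [hy, act_mul, act_mul]
    congr 1
    have h11 : C 1 1 = C 0 0 := by
      have hne : C 0 0 ≠ 0 := left_ne_zero_of_mul_eq_one hd
      apply mul_left_cancel₀ hne
      rw [hd, ← pow_two, h00]
    rcases (sq_eq_sq_iff_eq_or_eq_neg (b := (1 : ℂ))).mp (by rw [h00, one_pow]) with h | h
    · congr 1
      exact ext_SL2 (by simp [h]) (by simp [h]) (by simp [h10]) (by simp [h11, h])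
    · have : unip (C 0 1 * C 0 0) = -C :=
        ext_SL2 (by simp [h]) (by simp [h]) (by simp [h10]) (by simp [h11, h])
      rw [this]
      ext i
      fin_cases i <;> simp [act]
  have h1 := key (mem_univ (C 0 1 * C 0 0))
  simp only [hyψ, ← hC] at h1
  rw [hy, mul_entry, h1, h10]
  ring

/-- For x = a p + b q, the condition ⟨x, p⟩ = 1 forces b = 1/⟨p, q⟩, and ⟨x, x⟩ = 2ab⟨p, q⟩ = 1 then
forces a = 1/2. -/
theorem half_add_mem {p q : Mink} (hp : p ∈ lightCone) (hq : q ∈ lightCone) (hm : 0 < mink p q) :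
    (1 / 2 : ℝ) • p + (1 / mink p q) • q ∈ horosphere p ∧
      (1 / 2 : ℝ) • p + (1 / mink p q) • q ∈ geodesic p q := by
  have hh : (1 / 2 : ℝ) • p + (1 / mink p q) • q ∈ hyperboloid := by
    refine ⟨?_, ?_⟩
    · simp only [mink_add_left, mink_add_right, mink_smul_left, mink_smul_right, hp.1, hq.1,
        mink_comm q p]
      field_simp
      ring
    · have := hp.2
      have := hq.2
      simp only [Pi.add_apply, Pi.smul_apply, smul_eq_mul]
      positivity
  refine ⟨⟨hh, ?_⟩, hh, _, _, rfl⟩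
  rw [mink_add_left, mink_smul_left, mink_smul_left, hp.1, mink_comm q p]
  field_simp
  norm_num

theorem horosphere_nonempty {p : Mink} (hp : p ∈ lightCone) : (horosphere p).Nonempty := by
  have h1 := hp.1
  have h0 := hp.2
  simp only [mink] at h1
  -- Any second null direction will do; the antipodal one is explicit.
  refine ⟨_, (half_add_mem hp (q := ![p 0, -p 1, -p 2, -p 3]) ⟨by simp [mink]; linarith, h0⟩ ?_).1⟩
  simp [mink]
  nlinarith [mul_pos h0 h0]

/-- The spinor of a spin-decorated horosphere. -/
theorem SpinDecoratedHorosphere.exists_spinor (h : SpinDecoratedHorosphere) :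
    ∃ κ : Fin 2 → ℂ, h.base = spinorVec κ ∧
      ∀ x, h.outward x 0 0 = κ 0 ∧ h.outward x 1 0 = κ 1 ∧
        h.inward x = h.outward x * rot (Real.pi / 2) := by
  obtain ⟨V, hV, -, hout⟩ := h.exists_field
  obtain ⟨x₀, hx₀⟩ := horosphere_nonempty h.base_mem
  refine ⟨![h.outward ⟨x₀, hx₀⟩ 0 0, h.outward ⟨x₀, hx₀⟩ 1 0], ?_, fun x => ⟨?_, ?_, ?_⟩⟩
  · rw [← SpinHorosphere.act_north, hout.act_north]
  · exact hout.column_eq hV _ _ 0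
  · exact hout.column_eq hV _ _ 1
  · exact (SpinFrame.movesTo_rotation2 _ _ _).mp (h.associated x)

/-! ### Lambda lengths as brackets of spinors -/

open Classical in
/-- The point of `ℂ ∪ {∞}` with homogeneous coordinates `κ`. -/
noncomputable def spinorPt (κ : Fin 2 → ℂ) : OnePoint ℂ :=
  if κ 1 = 0 then OnePoint.infty else ((κ 0 / κ 1 : ℂ) : OnePoint ℂ)

/-- Here X + iY = 2κ₀κ̄₁ and T − Z = 2|κ₁|², so stereographic projection returns κ₀/κ₁. -/
theorem boundaryPoint_spinorVec (κ : Fin 2 → ℂ) : boundaryPoint (spinorVec κ) = spinorPt κ := by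
  by_cases h : κ 1 = 0
  · simp [boundaryPoint, spinorVec, spinorPt, h]
  · have hn : Complex.normSq (κ 1) ≠ 0 := by simpa using h
    have h1 : ¬ (spinorVec κ 0 = spinorVec κ 3) := by
      simp [spinorVec]
      intro h'
      exact hn (by linarith)
    rw [boundaryPoint, spinorPt, if_neg h1, if_neg h]
    congr 1
    have hc : (starRingEnd ℂ) (κ 1) ≠ 0 := by simpa using h
    have e1 : (spinorVec κ 1 : ℂ) + spinorVec κ 2 * Complex.I = 2 * (κ 0 * (starRingEnd ℂ) (κ 1)) := by
      apply Complex.ext <;> simp [spinorVec]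
    have e2 : (spinorVec κ 0 : ℂ) - spinorVec κ 3 = 2 * (κ 1 * (starRingEnd ℂ) (κ 1)) := by
      rw [Complex.mul_conj, ← Complex.ofReal_sub]
      simp [spinorVec]
      ring
    rw [e1, e2]
    field_simp

theorem spinorPt_eq_of_bracket {κ μ : Fin 2 → ℂ} (hκ : κ ≠ 0) (hμ : μ ≠ 0)
    (h : bracket κ μ = 0) : spinorPt κ = spinorPt μ := by
  have hz : ∀ κ : Fin 2 → ℂ, κ ≠ 0 → κ 1 = 0 → κ 0 ≠ 0 := fun κ hκ h1 h0 =>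
    hκ (by ext i; fin_cases i <;> assumption)
  simp only [bracket] at h
  by_cases h1 : κ 1 = 0
  · have : μ 1 = 0 := by simpa [h1, hz κ hκ h1] using h
    simp [spinorPt, h1, this]
  · by_cases h2 : μ 1 = 0
    · simp [h1, h2, hz μ hμ h2] at h
    · simp only [spinorPt, h1, h2, if_false]
      congr 1
      field_simp
      linear_combination h

theorem ne_zero_of_spinorVec_mem {κ : Fin 2 → ℂ} (h : spinorVec κ ∈ lightCone) : κ ≠ 0 := by
  rintro rfl
  have := h.2
  simp [spinorVec] at this

/-- The lambda length is the symplectic form of the spinors. -/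
theorem lambdaLength_eq_bracket {h₁ h₂ : SpinDecoratedHorosphere} (hc : h₁.centre ≠ h₂.centre)
    {κ μ : Fin 2 → ℂ} (hκ : h₁.base = spinorVec κ)
    (hκ' : ∀ x, h₁.outward x 0 0 = κ 0 ∧ h₁.outward x 1 0 = κ 1 ∧
      h₁.inward x = h₁.outward x * rot (Real.pi / 2))
    (hμ : h₂.base = spinorVec μ)
    (hμ' : ∀ x, h₂.outward x 0 0 = μ 0 ∧ h₂.outward x 1 0 = μ 1 ∧
      h₂.inward x = h₂.outward x * rot (Real.pi / 2)) :
    lambdaLength h₁ h₂ = bracket κ μ := by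
  have hl₁ := h₁.base_mem
  have hl₂ := h₂.base_mem
  have hb : bracket κ μ ≠ 0 := by
    intro hb
    apply hc
    rw [SpinDecoratedHorosphere.centre, SpinDecoratedHorosphere.centre, hκ, hμ,
      boundaryPoint_spinorVec, boundaryPoint_spinorVec]
    exact spinorPt_eq_of_bracket (ne_zero_of_spinorVec_mem (hκ ▸ hl₁))
      (ne_zero_of_spinorVec_mem (hμ ▸ hl₂)) hb
  have hm : mink h₁.base h₂.base = 2 * Complex.normSq (bracket κ μ) := by
    rw [hκ, hμ, mink_spinorVec]
  have hm0 : 0 < mink h₁.base h₂.base := by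
    rw [hm]
    have := Complex.normSq_pos.mpr hb
    positivity
  -- `rot (π / 2)` turns the columns (c₀, c₁) of `A` into (c₁, −c₀), and `expDiag` rescales them.
  have hrot : ∀ A B : SL2, ∀ d : ℂ, B = A * rot (Real.pi / 2) * expDiag (d / 2) ↔
      B 0 0 = A 0 1 * Complex.exp (d / 2) ∧ B 1 0 = A 1 1 * Complex.exp (d / 2) ∧
      B 0 1 = -A 0 0 * Complex.exp (-(d / 2)) ∧ B 1 1 = -A 1 0 * Complex.exp (-(d / 2)) := by
    intro A B d
    have e : ∀ i j, (A * rot (Real.pi / 2) * expDiag (d / 2) : SL2) i j =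
        (!![A 0 1 * Complex.exp (d / 2), -A 0 0 * Complex.exp (-(d / 2));
          A 1 1 * Complex.exp (d / 2), -A 1 0 * Complex.exp (-(d / 2))] : Matrix _ _ ℂ) i j := by
      intro i j
      rw [mul_entry, mul_entry, mul_entry]
      fin_cases i <;> fin_cases j <;> simp [-Complex.ofReal_cos, -Complex.ofReal_sin]
    constructor
    · rintro rfl
      simp [e]
    · rintro ⟨a, b, c, d⟩
      apply ext_SL2 <;> rw [e] <;> simp [a, b, c, d]
  -- μ is exp(d/2) times the second column of the first outward frame, whose first column is κ and
  -- whose determinant is 1. Every complex distance thus gives the same value, and the choice made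
  -- by `epsilon` is harmless.
  have hval : ∀ d, IsComplexDistance h₁ h₂ d → Complex.exp (d / 2) = bracket κ μ := by
    rintro d ⟨q₁, q₂, -, -, hd⟩
    rw [SpinFrame.isComplexDistance_iff, (hκ' q₁).2.2, hrot] at hd
    obtain ⟨h0, h1, -, -⟩ := hd
    rw [(hμ' q₂).1] at h0
    rw [(hμ' q₂).2.1] at h1
    have hdet := det_eq (h₁.outward q₁)
    rw [(hκ' q₁).1, (hκ' q₁).2.1] at hdet
    simp only [bracket]
    rw [h0, h1]
    linear_combination (-Complex.exp (d / 2)) * hdet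
  have hex : ∃ d, IsComplexDistance h₁ h₂ d := by
    obtain ⟨hq₁, hg₁⟩ := half_add_mem hl₁ hl₂ hm0
    obtain ⟨hq₂, hg₂⟩ := half_add_mem hl₂ hl₁ (by rwa [mink_comm])
    set q₁ : horosphere h₁.base := ⟨_, hq₁⟩ with hq₁_def
    set q₂ : horosphere h₂.base := ⟨_, hq₂⟩ with hq₂_def
    have hflip : ∀ p q : Mink, geodesic p q ⊆ geodesic q p := by
      rintro p q x ⟨hx, a, b, h⟩
      exact ⟨hx, b, a, by rw [h, add_comm]⟩
    refine ⟨2 * Complex.log (bracket κ μ), q₁, q₂, hg₁, hflip _ _ hg₂, ?_⟩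
    rw [SpinFrame.isComplexDistance_iff, (hκ' q₁).2.2, hrot,
      mul_div_cancel_left₀ _ (two_ne_zero), Complex.exp_neg, Complex.exp_log hb]
    obtain ⟨V₁, -, -, ho₁⟩ := h₁.exists_field
    obtain ⟨V₂, -, -, ho₂⟩ := h₂.exists_field
    -- The second column is a spinor of the backward endpoint: pos − e1 = 2x − p = (2/⟨p, q⟩) q.
    -- Hence it is proportional to the spinor of the other horosphere.
    have hs : ∀ (p q : Mink) (V : horosphere p → Mink) (W : horosphere p → SpinFrame)
        (x : horosphere p), IsOutwardSpinLift p V W →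
        (x : Mink) = (1 / 2 : ℝ) • p + (1 / mink p q) • q →
        spinorVec ![W x 0 1, W x 1 1] = (2 / mink p q) • q := by
      intro p q V W x hW hx
      rw [← act_south, ← base_sub_e1, (hW.2 x).1, (hW.2 x).2.1, hx]
      ext i
      simp only [Pi.sub_apply, Pi.add_apply, Pi.smul_apply, smul_eq_mul]
      ring
    have b₁ := bracket_eq_zero_of_spinorVec
      ((hs _ _ V₁ _ q₁ ho₁ rfl).trans (congrArg _ hμ))
    have b₂ := bracket_eq_zero_of_spinorVec
      ((hs _ _ V₂ _ q₂ ho₂ rfl).trans (congrArg _ hκ))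
    simp only [bracket, cons_val_zero, cons_val_one] at b₁ b₂
    have d₁ := det_eq (h₁.outward q₁)
    have d₂ := det_eq (h₂.outward q₂)
    rw [(hκ' q₁).1, (hκ' q₁).2.1] at d₁ ⊢
    rw [(hμ' q₂).1, (hμ' q₂).2.1] at d₂ ⊢
    have hb' : κ 0 * μ 1 - κ 1 * μ 0 ≠ 0 := hb
    simp only [bracket]
    refine ⟨?_, ?_, ?_, ?_⟩
    · linear_combination (-μ 0) * d₁ - κ 0 * b₁
    · linear_combination (-μ 1) * d₁ - κ 1 * b₁
    · rw [eq_mul_inv_iff_mul_eq₀ hb']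
      linear_combination (-κ 0) * d₂ - μ 0 * b₂
    · rw [eq_mul_inv_iff_mul_eq₀ hb']
      linear_combination (-κ 1) * d₂ - μ 1 * b₂
  rw [lambdaLength, if_neg hc]
  exact hval _ (Classical.epsilon_spec hex)

/-! ### Orientation of the tetrahedron -/

theorem celestial_spinorPt {κ : Fin 2 → ℂ} (hκ : κ ≠ 0) :
    celestial (spinorPt κ) = (spinorVec κ 0)⁻¹ • spinorVec κ := by
  by_cases h : κ 1 = 0
  · have h0 : κ 0 ≠ 0 := fun h0 => hκ (by ext i; fin_cases i <;> assumption)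
    have hn : Complex.normSq (κ 0) ≠ 0 := by simpa using h0
    rw [spinorPt, if_pos h]
    change ![1, 0, 0, 1] = _
    ext i
    fin_cases i <;> simp [spinorVec, h, hn]
  · have hn : 0 < Complex.normSq (κ 1) := Complex.normSq_pos.mpr h
    have hn0 := Complex.normSq_nonneg (κ 0)
    have hne : Complex.normSq (κ 0) + Complex.normSq (κ 1) ≠ 0 := by positivity
    have hne' : 1 + Complex.normSq (κ 0) / Complex.normSq (κ 1) ≠ 0 := by positivity
    rw [spinorPt, if_neg h]
    change ![1, 2 * (κ 0 / κ 1).re / (1 + Complex.normSq (κ 0 / κ 1)),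
      2 * (κ 0 / κ 1).im / (1 + Complex.normSq (κ 0 / κ 1)),
      (Complex.normSq (κ 0 / κ 1) - 1) / (1 + Complex.normSq (κ 0 / κ 1))] = _
    rw [Complex.normSq_div, Complex.div_re, Complex.div_im]
    ext i
    fin_cases i
    · simp [spinorVec, hne]
    all_goals
      simp [spinorVec]
      field_simp
      ring

/-- Used with μ = κ̄, where the right side is Ȳ W − Y W̄ = −2i Im(Y W̄) for Y, W the products of
brackets 02·13 and 03·12. -/
theorem det_tensor (κ μ : Fin 4 → Fin 2 → ℂ) :
    (Matrix.of fun i => ![κ i 0 * μ i 0, κ i 0 * μ i 1, κ i 1 * μ i 0, κ i 1 * μ i 1]).det =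
      bracket (μ 0) (μ 2) * bracket (μ 1) (μ 3) * (bracket (κ 0) (κ 3) * bracket (κ 1) (κ 2)) -
      bracket (κ 0) (κ 2) * bracket (κ 1) (κ 3) *
        (bracket (μ 0) (μ 3) * bracket (μ 1) (μ 2)) := by
  simp [Matrix.det_succ_row_zero, Fin.sum_univ_succ, Fin.succAbove, bracket]
  ring

/-- The signed volume of four light-cone vectors in terms of the brackets of their spinors. -/
theorem det_spinorVec (κ : Fin 4 → Fin 2 → ℂ) :
    (Matrix.of fun i => spinorVec (κ i)).det =
      -8 * (bracket (κ 0) (κ 2) * bracket (κ 1) (κ 3) *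
        star (bracket (κ 0) (κ 3) * bracket (κ 1) (κ 2))).im := by
  -- The constant matrix writes (T, X, Y, Z) in terms of the entries of κκ*. Its determinant −4i
  -- times −2i accounts for the factor −8.
  have hM : (Matrix.of fun i => spinorVec (κ i)).map Complex.ofRealHom =
      (Matrix.of fun i => ![κ i 0 * star (κ i) 0, κ i 0 * star (κ i) 1, κ i 1 * star (κ i) 0,
        κ i 1 * star (κ i) 1]) *
      !![1, 0, 0, 1; 0, 1, -Complex.I, 0; 0, 1, Complex.I, 0; 1, 0, 0, -1] := by
    ext i j
    fin_cases j <;> apply Complex.ext <;>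
      simp [spinorVec, Matrix.mul_apply, Fin.sum_univ_succ, Complex.normSq_apply] <;> ring
  have hK : (!![1, 0, 0, 1; 0, 1, -Complex.I, 0; 0, 1, Complex.I, 0; 1, 0, 0, -1] :
      Matrix (Fin 4) (Fin 4) ℂ).det = -4 * Complex.I := by
    simp [Matrix.det_succ_row_zero, Fin.sum_univ_succ, Fin.succAbove]
    ring
  have hs : ∀ i j, bracket (star (κ i)) (star (κ j)) = star (bracket (κ i) (κ j)) := by
    intro i j; simp [bracket]
  have h := congrArg Matrix.det hM
  rw [Matrix.det_mul, hK, det_tensor κ (fun i => star (κ i)), ← RingHom.mapMatrix_apply,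
    ← RingHom.map_det] at h
  simp only [hs] at h
  have h' := congrArg Complex.re h
  generalize bracket (κ 0) (κ 2) = a at *
  generalize bracket (κ 1) (κ 3) = b at *
  generalize bracket (κ 0) (κ 3) = c at *
  generalize bracket (κ 1) (κ 2) = d at *
  simp only [Complex.ofRealHom_eq_coe, Complex.ofReal_re] at h'
  rw [h']
  simp
  ring

/-! ### Shape parameters as cross ratios -/

theorem moebius_spinorPt (A : SL2) {κ : Fin 2 → ℂ} (hκ : κ ≠ 0) :
    moebius A (spinorPt κ) = spinorPt ((A : Matrix (Fin 2) (Fin 2) ℂ) *ᵥ κ) := by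
  by_cases h : κ 1 = 0
  · have h0 : κ 0 ≠ 0 := fun h0 => hκ (by ext i; fin_cases i <;> assumption)
    rw [spinorPt, if_pos h, moebius, OnePoint.smul_infty_eq_ite]
    by_cases hA : A 1 0 = 0 <;> simp [spinorPt, h, h0, hA, mul_div_mul_right]
  · rw [spinorPt, if_neg h, moebius, OnePoint.smul_some_eq_ite]
    have e : ∀ x y : ℂ, x * (κ 0 / κ 1) + y = (x * κ 0 + y * κ 1) / κ 1 := by
      intro x y; field_simp
    simp only [e]
    simp [spinorPt, h, div_div_div_cancel_right₀]

theorem bracket_mulVec (A : SL2) (κ μ : Fin 2 → ℂ) :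
    bracket ((A : Matrix (Fin 2) (Fin 2) ℂ) *ᵥ κ) ((A : Matrix (Fin 2) (Fin 2) ℂ) *ᵥ μ) =
      bracket κ μ := by
  simp [bracket]
  linear_combination (κ 0 * μ 1 - κ 1 * μ 0) * det_eq A

theorem spinorPt_eq_infty {κ : Fin 2 → ℂ} : spinorPt κ = OnePoint.infty ↔ κ 1 = 0 := by
  simp [spinorPt]

theorem spinorPt_eq_coe {κ : Fin 2 → ℂ} {z : ℂ} :
    spinorPt κ = (z : OnePoint ℂ) ↔ κ 1 ≠ 0 ∧ κ 0 = z * κ 1 := by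
  by_cases h : κ 1 = 0
  · simp [spinorPt, h]
  · simp [spinorPt, h, div_eq_iff]

theorem bracket_swap (κ μ : Fin 2 → ℂ) : bracket κ μ = -bracket μ κ := by
  simp only [bracket]; ring

theorem left_ne_zero_of_bracket {κ μ : Fin 2 → ℂ} (h : bracket κ μ ≠ 0) : κ ≠ 0 := by
  rintro rfl
  simp [bracket] at h

/-- The cross ratio of four spinors normalised to `0, ∞, 1, z`. -/
theorem cross_ratio_of_moebius {a b c d : Fin 2 → ℂ} (hab : bracket a b ≠ 0)
    (hca : bracket c a ≠ 0) (hda : bracket d a ≠ 0) {A : SL2} {z : ℂ}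
    (h0 : moebius A (spinorPt a) = ((0 : ℂ) : OnePoint ℂ))
    (h1 : moebius A (spinorPt b) = OnePoint.infty)
    (h2 : moebius A (spinorPt c) = ((1 : ℂ) : OnePoint ℂ))
    (h3 : moebius A (spinorPt d) = (z : OnePoint ℂ)) :
    z * (bracket a c * bracket b d) = bracket a d * bracket b c := by
  have hb : b ≠ 0 := left_ne_zero_of_bracket (μ := a) (by rwa [bracket_swap, neg_ne_zero])
  rw [moebius_spinorPt A (left_ne_zero_of_bracket hab), spinorPt_eq_coe] at h0
  rw [moebius_spinorPt A hb, spinorPt_eq_infty] at h1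
  rw [moebius_spinorPt A (left_ne_zero_of_bracket hca), spinorPt_eq_coe] at h2
  rw [moebius_spinorPt A (left_ne_zero_of_bracket hda), spinorPt_eq_coe] at h3
  -- Brackets are invariant under `A`, so the identity may be checked in the normalised position.
  rw [← bracket_mulVec A a c, ← bracket_mulVec A b d, ← bracket_mulVec A a d,
    ← bracket_mulVec A b c]
  generalize (A : Matrix (Fin 2) (Fin 2) ℂ) *ᵥ a = a' at *
  generalize (A : Matrix (Fin 2) (Fin 2) ℂ) *ᵥ b = b' at *
  generalize (A : Matrix (Fin 2) (Fin 2) ℂ) *ᵥ c = c' at *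
  generalize (A : Matrix (Fin 2) (Fin 2) ℂ) *ᵥ d = d' at *
  simp only [bracket, h0.2, h1, h2.2, h3.2]
  ring

/-- Three points can be moved to `0, ∞, 1`, and then a fourth one is moved to the cross ratio. -/
theorem exists_moebius {a b c d : Fin 2 → ℂ} (hab : bracket a b ≠ 0) (hac : bracket a c ≠ 0)
    (hbc : bracket b c ≠ 0) (had : bracket a d ≠ 0) (hbd : bracket b d ≠ 0) :
    ∃ A : SL2, moebius A (spinorPt a) = ((0 : ℂ) : OnePoint ℂ) ∧
      moebius A (spinorPt b) = OnePoint.infty ∧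
      moebius A (spinorPt c) = ((1 : ℂ) : OnePoint ℂ) ∧
      moebius A (spinorPt d) =
        ((bracket a d * bracket b c / (bracket a c * bracket b d) : ℂ) : OnePoint ℂ) := by
  have hsw : ∀ {κ μ}, bracket κ μ ≠ 0 → bracket μ κ ≠ 0 := fun h => by
    rwa [bracket_swap, neg_ne_zero]
  -- The map κ ↦ [`bracket a κ` : `bracket b κ`] sends a to 0 and b to ∞; weighting its rows by
  -- `bracket b c` and `bracket a c` sends c to 1. The scalar `s` makes the determinant 1.
  obtain ⟨s, hs⟩ := IsAlgClosed.exists_pow_nat_eq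
    (bracket b c * bracket a c * bracket a b)⁻¹ (n := 2) two_pos
  have hs' : s ^ 2 * (bracket b c * bracket a c * bracket a b) = 1 := by
    rw [hs]; exact inv_mul_cancel₀ (by simp [*])
  have hs0 : s ≠ 0 := by rintro rfl; simp at hs'
  let A : SL2 := ⟨!![-(s * bracket b c * a 1), s * bracket b c * a 0;
    -(s * bracket a c * b 1), s * bracket a c * b 0], by
      rw [Matrix.det_fin_two]
      simp
      rw [← hs']
      simp only [bracket]
      ring⟩
  have hA : ∀ κ, (A : Matrix (Fin 2) (Fin 2) ℂ) *ᵥ κ =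
      ![s * bracket b c * bracket a κ, s * bracket a c * bracket b κ] := by
    intro κ
    ext i
    fin_cases i <;> simp [A, bracket, vecHead, vecTail] <;> ring
  have haa : ∀ κ, bracket κ κ = 0 := fun κ => by simp only [bracket]; ring
  refine ⟨A, ?_, ?_, ?_, ?_⟩
  · rw [moebius_spinorPt A (left_ne_zero_of_bracket hab), spinorPt_eq_coe, hA]
    simp [haa, hs0, hac, hsw hab]
  · rw [moebius_spinorPt A (left_ne_zero_of_bracket hbc), spinorPt_eq_infty, hA]
    simp [haa]
  · rw [moebius_spinorPt A (left_ne_zero_of_bracket (hsw hac)), spinorPt_eq_coe, hA]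
    simp [hs0, hac, hbc]
    ring
  · rw [moebius_spinorPt A (left_ne_zero_of_bracket (hsw had)), spinorPt_eq_coe, hA]
    simp [hs0, hac, hbd]
    field_simp

theorem inv_im_neg {z w : ℂ} (hw : 0 < w.im) (h : z * w = 1) : z.im < 0 := by
  have hz : z = w⁻¹ := eq_inv_of_mul_eq_one_left h
  have hw0 : w ≠ 0 := right_ne_zero_of_mul_eq_one h
  rw [hz, Complex.inv_im]
  exact div_neg_of_neg_of_pos (by linarith) (Complex.normSq_pos.mpr hw0)

/-- The definition allows exchanging 0 with ∞ and `k` with `l`. One exchange inverts the cross ratio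
and both together preserve it; the inverse lies in the lower half plane and is excluded. -/
theorem isShapeParameter_iff {v : Fin 4 → OnePoint ℂ} {κ : Fin 4 → Fin 2 → ℂ}
    (hv : ∀ i, v i = spinorPt (κ i)) (hD : ∀ i j, i ≠ j → bracket (κ i) (κ j) ≠ 0)
    {i j k l : Fin 4} (hu : ({i, j, k, l} : Finset (Fin 4)) = Finset.univ)
    (him : 0 < (bracket (κ i) (κ l) * bracket (κ j) (κ k) /
      (bracket (κ i) (κ k) * bracket (κ j) (κ l))).im) (z : ℂ) :
    IsShapeParameter v i j z ↔ z = bracket (κ i) (κ l) * bracket (κ j) (κ k) /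
      (bracket (κ i) (κ k) * bracket (κ j) (κ l)) := by
  have hne : ∀ i j k l : Fin 4, ({i, j, k, l} : Finset (Fin 4)) = Finset.univ →
      i ≠ j ∧ i ≠ k ∧ i ≠ l ∧ j ≠ k ∧ j ≠ l ∧ k ≠ l := by decide
  have hkl : ∀ i j k l k' l' : Fin 4, ({i, j, k, l} : Finset (Fin 4)) = Finset.univ →
      ({i, j, k', l'} : Finset (Fin 4)) = Finset.univ →
      (k' = k ∧ l' = l) ∨ (k' = l ∧ l' = k) := by decide
  obtain ⟨hij, hik, hil, hjk, hjl, -⟩ := hne i j k l hu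
  have d1 := hD _ _ hik
  have d2 := hD _ _ hjl
  have d3 := hD _ _ hil
  have d4 := hD _ _ hjk
  constructor
  · rintro ⟨hz, A, k', l', hu', hor, h1, hl⟩
    simp only [hv] at hor h1 hl
    have bad : ∀ w : ℂ, w * (bracket (κ i) (κ l) * bracket (κ j) (κ k)) =
        bracket (κ i) (κ k) * bracket (κ j) (κ l) → w.im < 0 := by
      intro w hw
      refine inv_im_neg him ?_
      rw [← mul_div_assoc, hw]
      exact div_self (mul_ne_zero d1 d2)
    rcases hkl _ _ _ _ _ _ hu hu' with ⟨rfl, rfl⟩ | ⟨rfl, rfl⟩ <;>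
      rcases hor with ⟨ha, hb⟩ | ⟨hb, ha⟩
    · rw [eq_div_iff (mul_ne_zero d1 d2)]
      exact cross_ratio_of_moebius (hD _ _ hij) (hD _ _ hik.symm) (hD _ _ hil.symm) ha hb h1 hl
    · have := cross_ratio_of_moebius (hD _ _ hij.symm) (hD _ _ hjk.symm) (hD _ _ hjl.symm) ha hb h1 hl
      exact absurd (bad z (by linear_combination this)) hz.not_gt
    · have := cross_ratio_of_moebius (hD _ _ hij) (hD _ _ hil.symm) (hD _ _ hik.symm) ha hb h1 hl
      exact absurd (bad z this) hz.not_gt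
    · rw [eq_div_iff (mul_ne_zero d1 d2)]
      have := cross_ratio_of_moebius (hD _ _ hij.symm) (hD _ _ hjl.symm) (hD _ _ hjk.symm) ha hb h1 hl
      linear_combination this
  · rintro rfl
    obtain ⟨A, h0, h1, h2, h3⟩ := exists_moebius (hD _ _ hij) d1 d4 d3 d2
    refine ⟨him, A, k, l, hu, Or.inl ?_, ?_, ?_⟩ <;> simp only [hv]
    · exact ⟨h0, h1⟩
    · exact h2
    · exact h3

/-- The three cross ratios attached to `x - y + w = 0` lie in the upper half plane together. -/
theorem im_cross_ratios {x y w : ℂ} (hxy : x = y - w) (hx : x ≠ 0) (hy : y ≠ 0) (hw : w ≠ 0)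
    (him : 0 < (y * star w).im) :
    0 < (y / w).im ∧ 0 < (-(w / x)).im ∧ 0 < (x / y).im := by
  have key : ∀ {a b : ℂ}, b ≠ 0 → 0 < (a * star b).im → 0 < (a / b).im := by
    intro a b hb h
    have hn := Complex.normSq_pos.mpr hb
    rw [div_eq_mul_inv, Complex.inv_def, ← mul_assoc, Complex.im_mul_ofReal]
    exact mul_pos h (inv_pos.mpr hn)
  refine ⟨key hw him, ?_, key hy ?_⟩
  -- With x = y − w, the terms |w|² and |y|² are real, so Im(−w x̄) and Im(x ȳ) both equal Im(y w̄).
  · rw [← neg_div]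
    refine key hx ?_
    rw [hxy]
    simp at him ⊢
    linarith
  · rw [hxy]
    simp at him ⊢
    linarith

end SpinHorosphere

/-! ### The main theorem -/

open SpinHorosphere in
theorem mainTheorem5 (v : Fin 4 → OnePoint ℂ)
    (hv : SpinHorosphere.IsOrientedIdealTetrahedron v)
    (h : Fin 4 → SpinHorosphere.SpinDecoratedHorosphere) (hc : ∀ i, (h i).centre = v i)
    (lam : Fin 4 → Fin 4 → ℂ) (hlam : ∀ i j, lam i j = SpinHorosphere.lambdaLength (h i) (h j)) :
    (∀ z : ℂ, SpinHorosphere.IsShapeParameter v 0 1 z ↔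
      z = lam 0 2 * lam 1 3 / (lam 0 3 * lam 1 2)) ∧
    (∀ z : ℂ, SpinHorosphere.IsShapeParameter v 2 3 z ↔
      z = lam 0 2 * lam 1 3 / (lam 0 3 * lam 1 2)) ∧
    (∀ z : ℂ, SpinHorosphere.IsShapeParameter v 0 2 z ↔
      z = -(lam 0 3 * lam 1 2 / (lam 0 1 * lam 2 3))) ∧
    (∀ z : ℂ, SpinHorosphere.IsShapeParameter v 1 3 z ↔
      z = -(lam 0 3 * lam 1 2 / (lam 0 1 * lam 2 3))) ∧
    (∀ z : ℂ, SpinHorosphere.IsShapeParameter v 0 3 z ↔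
      z = lam 0 1 * lam 2 3 / (lam 0 2 * lam 1 3)) ∧
    (∀ z : ℂ, SpinHorosphere.IsShapeParameter v 1 2 z ↔
      z = lam 0 1 * lam 2 3 / (lam 0 2 * lam 1 3)) := by
  choose κ hκ hκ' using fun i => (h i).exists_spinor
  have hpt : ∀ i, v i = spinorPt (κ i) := fun i => by
    rw [← hc, SpinDecoratedHorosphere.centre, hκ, boundaryPoint_spinorVec]
  have hκ0 : ∀ i, κ i ≠ 0 := fun i => ne_zero_of_spinorVec_mem (hκ i ▸ (h i).base_mem)
  have hvne : ∀ i j, i ≠ j → v i ≠ v j := by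
    intro i j hij he
    have : (Matrix.of fun i => celestial (v i)).det = 0 :=
      Matrix.det_zero_of_row_eq hij (congrArg celestial he)
    exact hv.ne this
  have hl : ∀ i j, i ≠ j → lam i j = bracket (κ i) (κ j) := fun i j hij => by
    rw [hlam]
    exact lambdaLength_eq_bracket (by rw [hc, hc]; exact hvne i j hij) (hκ i) (hκ' i) (hκ j) (hκ' j)
  have hD : ∀ i j, i ≠ j → bracket (κ i) (κ j) ≠ 0 := fun i j hij h0 => hvne i j hij (by
    rw [hpt, hpt]
    exact spinorPt_eq_of_bracket (hκ0 i) (hκ0 j) h0)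
  have him : 0 < (bracket (κ 0) (κ 2) * bracket (κ 1) (κ 3) *
      star (bracket (κ 0) (κ 3) * bracket (κ 1) (κ 2))).im := by
    -- Passing from the rays normalised by T = 1 to the vectors κκ* rescales rows by positive
    -- factors, which keeps the sign of the determinant.
    have h1 : (Matrix.of fun i => celestial (v i)).det =
        (∏ i, (spinorVec (κ i) 0)⁻¹) * (Matrix.of fun i => spinorVec (κ i)).det := by
      rw [← Matrix.det_mul_column]
      congr 1
      ext i j
      simp [hpt, celestial_spinorPt (hκ0 i)]
    have hpos : 0 < ∏ i, (spinorVec (κ i) 0)⁻¹ :=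
      Finset.prod_pos fun i _ => inv_pos.mpr (hκ i ▸ (h i).base_mem).2
    have h2 : (Matrix.of fun i => celestial (v i)).det < 0 := hv
    rw [h1, det_spinorVec] at h2
    have h3 := (pos_iff_neg_of_mul_neg h2).mp hpos
    linarith
  -- The relation x = y − w is the Plücker identity for four vectors in ℂ².
  obtain ⟨i1, i2, i3⟩ := im_cross_ratios
    (x := bracket (κ 0) (κ 1) * bracket (κ 2) (κ 3)) (by simp only [bracket]; ring)
    (mul_ne_zero (hD 0 1 (by decide)) (hD 2 3 (by decide)))
    (mul_ne_zero (hD 0 2 (by decide)) (hD 1 3 (by decide)))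
    (mul_ne_zero (hD 0 3 (by decide)) (hD 1 2 (by decide))) him
  rw [hl 0 1 (by decide), hl 0 2 (by decide), hl 0 3 (by decide), hl 1 2 (by decide),
    hl 1 3 (by decide), hl 2 3 (by decide)]
  have shape : ∀ (i j k l : Fin 4) (ζ : ℂ), ({i, j, k, l} : Finset (Fin 4)) = Finset.univ →
      0 < ζ.im → bracket (κ i) (κ l) * bracket (κ j) (κ k) /
        (bracket (κ i) (κ k) * bracket (κ j) (κ l)) = ζ →
      ∀ z, IsShapeParameter v i j z ↔ z = ζ := by
    rintro i j k l ζ hu hζ rfl z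
    exact isShapeParameter_iff hpt hD hu hζ z
  -- For each edge the remaining vertices are ordered so that the cross ratio, rather than its
  -- inverse, has positive imaginary part. What remains is antisymmetry of the bracket.
  refine ⟨shape 0 1 3 2 _ (by decide) i1 ?_, shape 2 3 1 0 _ (by decide) i1 ?_,
    shape 0 2 1 3 _ (by decide) i2 ?_, shape 1 3 0 2 _ (by decide) i2 ?_,
    shape 0 3 2 1 _ (by decide) i3 ?_, shape 1 2 3 0 _ (by decide) i3 ?_⟩
  · rfl
  · rw [bracket_swap (κ 2) (κ 0), bracket_swap (κ 3) (κ 1), bracket_swap (κ 2) (κ 1),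
      bracket_swap (κ 3) (κ 0)]
    rw [neg_mul_neg, neg_mul_neg, mul_comm (bracket (κ 1) (κ 2))]
  · rw [bracket_swap (κ 2) (κ 1), mul_neg, neg_div]
  · rw [bracket_swap (κ 3) (κ 0), bracket_swap (κ 1) (κ 0), bracket_swap (κ 3) (κ 2),
      mul_neg, neg_mul_neg, neg_div, mul_comm (bracket (κ 1) (κ 2))]
  · rw [bracket_swap (κ 3) (κ 2), bracket_swap (κ 3) (κ 1), mul_neg, mul_neg, neg_div_neg_eq]
  · rw [bracket_swap (κ 1) (κ 0), bracket_swap (κ 2) (κ 0), neg_mul, mul_neg, neg_div_neg_eq,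
      mul_comm (bracket (κ 1) (κ 3))]
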